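/- Let $\Omega\subset\mathbb{R}^n$ be a bounded domain (open and connected) with $C^2$ boundary and $0\in\Omega$, and let $F:\overline{\Omega}\to\mathbb{R}^n$ be a vector field of class $C^3$ on $\overline\Omega$ with $F(0)=0$. If $\nabla\cdot F(0)<0$, then $F$ has a Helmholtz--Hodge decomposition on $\Omega$ whose potential has a strict local minimum at the origin; that is, there are a $C^3$ function $V:\Omega\to\mathbb{R}$ and a $C^2$ vector field $u:\Omega\to\mathbb{R}^n$ with $\nabla\cdot u=0$ on $\Omega$ and $F=-\nabla V+u$ on $\Omega$, such that $V(x)>V(0)$ for all $x\neq 0$ in some neighbourhood of $0$. -/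

import Mathlib

open scoped Topology

noncomputable section

/-- The divergence of a vector field on `ℝⁿ`: the sum of the partial derivatives `∂ Fᵢ / ∂ xᵢ`. -/
def divergence {n : ℕ} (F : EuclideanSpace ℝ (Fin n) → EuclideanSpace ℝ (Fin n))
    (x : EuclideanSpace ℝ (Fin n)) : ℝ :=
  ∑ i : Fin n, (fderiv ℝ F x (EuclideanSpace.single i 1)) i

/-- The boundary of `Ω` is of class `C²`: near each boundary point `p`, the set `Ω` is the sublevel
set `{ρ < 0}` of a `C²` function `ρ` with `ρ p = 0` and nonvanishing differential at `p`. -/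
def HasC2Boundary {n : ℕ} (Ω : Set (EuclideanSpace ℝ (Fin n))) : Prop :=
  ∀ p ∈ frontier Ω, ∃ U : Set (EuclideanSpace ℝ (Fin n)), IsOpen U ∧ p ∈ U ∧
    ∃ ρ : EuclideanSpace ℝ (Fin n) → ℝ, ContDiffOn ℝ 2 ρ U ∧ ρ p = 0 ∧ fderiv ℝ ρ p ≠ 0 ∧
      Ω ∩ U = {x ∈ U | ρ x < 0}

/-- A bounded domain of `ℝⁿ` (open and connected) with `C²` boundary. -/
structure IsBoundedC2Domain {n : ℕ} (Ω : Set (EuclideanSpace ℝ (Fin n))) : Prop where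
  isOpen : IsOpen Ω
  isConnected : IsConnected Ω
  isBounded : Bornology.IsBounded Ω
  boundary : HasC2Boundary Ω

/-- `F = -∇V + u` is a Helmholtz–Hodge decomposition of `F` on the open set `Ω`: the potential `V` is
`C³` on `Ω`, and `u` is a (`C²`) vector field on `Ω` whose divergence vanishes. -/
structure IsHHD {n : ℕ} (Ω : Set (EuclideanSpace ℝ (Fin n)))
    (F : EuclideanSpace ℝ (Fin n) → EuclideanSpace ℝ (Fin n))
    (V : EuclideanSpace ℝ (Fin n) → ℝ)
    (u : EuclideanSpace ℝ (Fin n) → EuclideanSpace ℝ (Fin n)) : Prop where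
  contDiffOn_potential : ContDiffOn ℝ 3 V Ω
  contDiffOn_field : ContDiffOn ℝ 2 u Ω
  divergence_eq_zero : ∀ x ∈ Ω, divergence u x = 0
  eq : ∀ x ∈ Ω, F x = -gradient V x + u x

end

/-! If `ΔV = -div F` on `Ω`, then `u = F + ∇V` is divergence free, so a decomposition amounts to a
solution of Poisson's equation, and the potential may be changed by any harmonic function. At the
origin `ΔV(0) = -div F(0) > 0`: the Hessian has positive trace, though it need not be positive
definite. Adding a quadratic polynomial with derivative `-DV(0)` and Hessian `(ΔV(0)/n) I - D²V(0)`
makes the origin a critical point with Hessian `(ΔV(0)/n) I`. This polynomial is harmonic because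
its Hessian has trace zero, and the second derivative test gives the strict minimum
(`exists_harmonic_add_strict_local_min`).

The analytic work is `exists_laplacian_eq`: a bounded `C²` right-hand side on a bounded open set has
a `C³` solution. It is the Newtonian potential of the extension by zero. The kernel is regularised
by replacing `‖y‖²` with `‖y‖² + ε`; the limit `ε → 0` identifies its distributional gradient and
Laplacian (`integral_newtonKernel_mul_fderiv`, `integral_newtonWeight_zero_mul_fderiv_self`).
Boundedness of `div F` follows from the regularity of `F` up to the boundary
(`exists_norm_fderiv_le_of_contDiffOn_closure`). -/

open MeasureTheory Module Filter Set

/-! ### The radial profile, uniformly in the dimension. -/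

/-- The radial profile of the fundamental solution of the Laplacian in dimension `d`, as a function
of the squared distance to the origin. -/
noncomputable def newtonProfile (d : ℕ) (s : ℝ) : ℝ :=
  2⁻¹ * ∫ t in (1 : ℝ)..s, t ^ (-(d : ℝ) / 2)

theorem intervalIntegrable_rpow_of_pos {a b r : ℝ} (ha : 0 < a) (hb : 0 < b) :
    IntervalIntegrable (fun t : ℝ => t ^ r) volume a b :=
  intervalIntegral.intervalIntegrable_rpow (Or.inr fun h =>
    absurd (lt_of_lt_of_le (lt_min ha hb) h.1) (lt_irrefl _))

theorem hasDerivAt_newtonProfile (d : ℕ) {s : ℝ} (hs : 0 < s) :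
    HasDerivAt (newtonProfile d) (2⁻¹ * s ^ (-(d : ℝ) / 2)) s := by
  unfold newtonProfile
  refine HasDerivAt.const_mul _ ?_
  refine intervalIntegral.integral_hasDerivAt_right
    (intervalIntegrable_rpow_of_pos one_pos hs) ?_ ?_
  · exact (ContinuousOn.stronglyMeasurableAtFilter (s := Ioi 0) isOpen_Ioi
      (fun t ht => (Real.continuousAt_rpow_const t _ (Or.inl (ne_of_gt ht))).continuousWithinAt)) s hs
  · exact Real.continuousAt_rpow_const s _ (Or.inl hs.ne')

theorem contDiffOn_newtonProfile (d : ℕ) : ContDiffOn ℝ (⊤ : ℕ∞) (newtonProfile d) (Ioi 0) := by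
  rw [contDiffOn_infty_iff_deriv_of_isOpen isOpen_Ioi]
  refine ⟨fun s hs => (hasDerivAt_newtonProfile d hs).differentiableAt.differentiableWithinAt, ?_⟩
  refine ContDiffOn.congr (f := fun s => 2⁻¹ * s ^ (-(d : ℝ) / 2)) ?_
    fun s hs => (hasDerivAt_newtonProfile d hs).deriv
  exact contDiffOn_const.mul fun s hs =>
    (Real.contDiffAt_rpow_const_of_ne (ne_of_gt hs)).contDiffWithinAt

/-- For `s ≤ 1`, write `t^(-d/2) = t^((1-d)/2) * t^(-1/2)`: the first factor is largest at `t = s`,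
the second has integral at most `2`. With `s = ‖y‖²` this gives `‖y‖^(1-d)`, which is not sharp but
is locally integrable and needs no separate logarithmic case `d = 2`. -/
theorem abs_newtonProfile_le (d : ℕ) (hd : 1 ≤ d) {s : ℝ} (hs : 0 < s) :
    |newtonProfile d s| ≤ s + s ^ ((1 - (d : ℝ)) / 2) := by
  have hd' : (1 : ℝ) ≤ d := by exact_mod_cast hd
  have hpos : 0 < s ^ ((1 - (d : ℝ)) / 2) := Real.rpow_pos_of_pos hs _
  unfold newtonProfile
  rw [abs_mul, abs_of_pos (by norm_num : (0 : ℝ) < 2⁻¹)]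
  rcases le_total 1 s with h | h
  · have := intervalIntegral.norm_integral_le_of_norm_le_const (a := 1) (b := s) (C := 1)
      (f := fun t : ℝ => t ^ (-(d : ℝ) / 2)) (fun t ht => by
        rw [uIoc_of_le h] at ht
        rw [Real.norm_of_nonneg (Real.rpow_nonneg (by linarith [ht.1]) _)]
        exact Real.rpow_le_one_of_one_le_of_nonpos ht.1.le (by linarith))
    rw [Real.norm_eq_abs, abs_of_nonneg (by linarith : 0 ≤ s - 1)] at this
    linarith
  · have h1 := intervalIntegral.norm_integral_le_of_norm_le (μ := volume) h
      (f := fun t : ℝ => t ^ (-(d : ℝ) / 2))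
      (g := fun t : ℝ => s ^ ((1 - (d : ℝ)) / 2) * t ^ (-(1 : ℝ) / 2))
      (ae_of_all _ fun t ht => by
        have ht0 : 0 < t := hs.trans ht.1
        rw [Real.norm_of_nonneg (Real.rpow_nonneg ht0.le _)]
        have : t ^ (-(d : ℝ) / 2) = t ^ ((1 - (d : ℝ)) / 2) * t ^ (-(1 : ℝ) / 2) := by
          rw [← Real.rpow_add ht0]; ring_nf
        rw [this]
        exact mul_le_mul_of_nonneg_right
          (Real.rpow_le_rpow_of_nonpos hs ht.1.le (by linarith)) (Real.rpow_nonneg ht0.le _))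
      ((intervalIntegrable_rpow_of_pos hs one_pos).const_mul _)
    have h2 : ∫ t in s..1, t ^ (-(1 : ℝ) / 2) ≤ 2 := by
      rw [integral_rpow (Or.inl (by norm_num))]
      have : 0 < s ^ (-(1 : ℝ) / 2 + 1) := Real.rpow_pos_of_pos hs _
      rw [Real.one_rpow, div_le_iff₀ (by norm_num)]
      linarith
    rw [intervalIntegral.integral_const_mul] at h1
    rw [intervalIntegral.integral_symm, abs_neg]
    rw [Real.norm_eq_abs] at h1
    nlinarith [mul_le_mul_of_nonneg_left h2 hpos.le]

/-! ### The regularised kernel: derivatives, bounds uniform in `ε`, local integrability. -/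

section Kernel

theorem add_rpow_le_norm_rpow {E : Type*} [NormedAddCommGroup E] {ε r : ℝ} (hε : 0 ≤ ε) (hr : r ≤ 0) {y : E} (hy : y ≠ 0) :
    (‖y‖ ^ 2 + ε) ^ (r / 2) ≤ ‖y‖ ^ r := by
  have hy' : 0 < ‖y‖ := norm_pos_iff.2 hy
  calc (‖y‖ ^ 2 + ε) ^ (r / 2) ≤ (‖y‖ ^ 2) ^ (r / 2) :=
        Real.rpow_le_rpow_of_nonpos (by positivity) (by linarith) (by linarith)
    _ = ‖y‖ ^ r := by
        rw [← Real.rpow_natCast, ← Real.rpow_mul hy'.le]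
        congr 1
        push_cast
        ring

variable {E : Type*} [NormedAddCommGroup E] [InnerProductSpace ℝ E]

/-- The regularised fundamental solution of the Laplacian on `E`, up to a multiplicative and an
additive constant; `ε = 0` gives the fundamental solution itself. -/
noncomputable def newtonKernel (E : Type*) [NormedAddCommGroup E] [InnerProductSpace ℝ E]
    (ε : ℝ) (y : E) : ℝ :=
  newtonProfile (finrank ℝ E) (‖y‖ ^ 2 + ε)

/-- The radial coefficient of the gradient of `newtonKernel`. -/
noncomputable def newtonWeight (E : Type*) [NormedAddCommGroup E] [InnerProductSpace ℝ E]
    (ε : ℝ) (y : E) : ℝ :=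
  (‖y‖ ^ 2 + ε) ^ (-(finrank ℝ E : ℝ) / 2)

theorem hasFDerivAt_newtonKernel {ε : ℝ} {y : E} (h : 0 < ‖y‖ ^ 2 + ε) :
    HasFDerivAt (newtonKernel E ε) (newtonWeight E ε y • innerSL ℝ y) y := by
  have h1 : HasFDerivAt (fun y : E => ‖y‖ ^ 2 + ε) (2 • innerSL ℝ y) y :=
    (hasStrictFDerivAt_norm_sq y).hasFDerivAt.add_const ε
  have h2 : HasFDerivAt (newtonKernel E ε) _ y :=
    (hasDerivAt_newtonProfile (finrank ℝ E) h).comp_hasFDerivAt y h1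
  refine h2.congr_fderiv ?_
  ext v
  simp [newtonWeight]
  ring

theorem hasFDerivAt_newtonWeight {ε : ℝ} {y : E} (h : 0 < ‖y‖ ^ 2 + ε) :
    HasFDerivAt (newtonWeight E ε)
      ((-(finrank ℝ E : ℝ) * (‖y‖ ^ 2 + ε) ^ (-(finrank ℝ E : ℝ) / 2 - 1)) • innerSL ℝ y) y := by
  have h1 : HasFDerivAt (fun y : E => ‖y‖ ^ 2 + ε) (2 • innerSL ℝ y) y :=
    (hasStrictFDerivAt_norm_sq y).hasFDerivAt.add_const ε
  have h2 : HasFDerivAt (newtonWeight E ε) _ y :=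
    h1.rpow_const (p := -(finrank ℝ E : ℝ) / 2) (Or.inl h.ne')
  refine h2.congr_fderiv ?_
  ext v
  simp
  ring

theorem contDiffAt_newtonKernel {ε : ℝ} {y : E} (h : 0 < ‖y‖ ^ 2 + ε) :
    ContDiffAt ℝ (⊤ : ℕ∞) (newtonKernel E ε) y :=
  ((contDiffOn_newtonProfile (finrank ℝ E)).contDiffAt (Ioi_mem_nhds h)).comp y
    ((contDiff_norm_sq ℝ).add contDiff_const).contDiffAt

theorem continuous_newtonWeight {ε : ℝ} (hε : 0 < ε) : Continuous (newtonWeight E ε) :=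
  Continuous.rpow_const (by fun_prop) fun y => Or.inl (by positivity)

/-- The derivative of one component of the gradient of `newtonKernel`. -/
theorem hasFDerivAt_newtonWeight_mul_inner {ε : ℝ} {y : E} (h : 0 < ‖y‖ ^ 2 + ε) (v : E) :
    HasFDerivAt (fun y => newtonWeight E ε y * inner ℝ y v)
      (newtonWeight E ε y • innerSL ℝ v + inner ℝ y v •
        ((-(finrank ℝ E : ℝ) * (‖y‖ ^ 2 + ε) ^ (-(finrank ℝ E : ℝ) / 2 - 1)) • innerSL ℝ y)) y := by
  have h1 : HasFDerivAt (fun y : E => inner ℝ y v) (innerSL ℝ v) y := by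
    simpa [real_inner_comm] using (innerSL ℝ v).hasFDerivAt (x := y)
  exact (hasFDerivAt_newtonWeight h).mul h1

/-- The Laplacian of `newtonKernel`, in an orthonormal basis. -/
theorem sum_newtonWeight_second_derivative {ι : Type*} [Fintype ι] (b : OrthonormalBasis ι ℝ E)
    {ε : ℝ} {y : E} (h : 0 < ‖y‖ ^ 2 + ε) :
    ∑ i, (newtonWeight E ε y • innerSL ℝ (b i) + inner ℝ y (b i) •
        ((-(finrank ℝ E : ℝ) * (‖y‖ ^ 2 + ε) ^ (-(finrank ℝ E : ℝ) / 2 - 1)) • innerSL ℝ y)) (b i) =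
      finrank ℝ E * ε * (‖y‖ ^ 2 + ε) ^ (-(finrank ℝ E : ℝ) / 2 - 1) := by
  set p := (‖y‖ ^ 2 + ε) ^ (-(finrank ℝ E : ℝ) / 2 - 1) with hp
  -- With `d` the dimension, the trace is `d * w - d * p * ‖y‖²`; writing `w` as `p * (‖y‖² + ε)`
  -- leaves only `d * p * ε`.
  have hw : newtonWeight E ε y = p * (‖y‖ ^ 2 + ε) := by
    rw [newtonWeight, hp, ← Real.rpow_add_one h.ne']
    ring_nf
  have h1 : ∀ i, (newtonWeight E ε y • innerSL ℝ (b i) + inner ℝ y (b i) •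
        ((-(finrank ℝ E : ℝ) * p) • innerSL ℝ y)) (b i) =
      newtonWeight E ε y - finrank ℝ E * p * inner ℝ y (b i) ^ 2 := by
    intro i
    simp
    ring
  rw [Finset.sum_congr rfl fun i _ => h1 i, Finset.sum_sub_distrib, ← Finset.mul_sum,
    b.sum_sq_inner_left, hw, Finset.sum_const, Finset.card_univ, ← finrank_eq_card_basis b.toBasis]
  simp
  ring

theorem newtonWeight_nonneg {ε : ℝ} (hε : 0 ≤ ε) (y : E) : 0 ≤ newtonWeight E ε y :=
  Real.rpow_nonneg (by positivity) _

theorem abs_newtonKernel_le [FiniteDimensional ℝ E] [Nontrivial E] {ε : ℝ} (hε : 0 ≤ ε)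
    (hε' : ε ≤ 1) {y : E} (hy : y ≠ 0) :
    |newtonKernel E ε y| ≤ ‖y‖ ^ 2 + 1 + ‖y‖ ^ (1 - (finrank ℝ E : ℝ)) := by
  have hy' : 0 < ‖y‖ := norm_pos_iff.2 hy
  have hd : 1 ≤ finrank ℝ E := finrank_pos
  have hd' : (1 : ℝ) ≤ finrank ℝ E := by exact_mod_cast hd
  refine (abs_newtonProfile_le _ hd (by positivity)).trans ?_
  have := add_rpow_le_norm_rpow hε (r := 1 - (finrank ℝ E : ℝ)) (by linarith) hy
  linarith

theorem newtonWeight_mul_norm_le {ε : ℝ} (hε : 0 ≤ ε) {y : E} (hy : y ≠ 0) :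
    newtonWeight E ε y * ‖y‖ ≤ ‖y‖ ^ (1 - (finrank ℝ E : ℝ)) := by
  have hy' : 0 < ‖y‖ := norm_pos_iff.2 hy
  have := add_rpow_le_norm_rpow hε (r := -(finrank ℝ E : ℝ)) (by simp) hy
  calc newtonWeight E ε y * ‖y‖ ≤ ‖y‖ ^ (-(finrank ℝ E : ℝ)) * ‖y‖ :=
        mul_le_mul_of_nonneg_right this hy'.le
    _ = ‖y‖ ^ (1 - (finrank ℝ E : ℝ)) := by
        rw [← Real.rpow_add_one hy'.ne']; ring_nf

variable [MeasurableSpace E] [BorelSpace E]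

theorem measurable_newtonWeight (ε : ℝ) : Measurable (newtonWeight E ε) := by
  unfold newtonWeight
  fun_prop

variable [FiniteDimensional ℝ E] [Nontrivial E]

/-- In polar coordinates the Jacobian `t^(d-1)` cancels the singularity exactly, leaving the
constant `1`. -/
theorem locallyIntegrable_norm_rpow_one_sub_finrank :
    LocallyIntegrable (fun y : E => ‖y‖ ^ (1 - (finrank ℝ E : ℝ))) volume := by
  intro x
  refine ⟨Metric.ball 0 (‖x‖ + 1), Metric.isOpen_ball.mem_nhds (by simp), ?_⟩
  refine (integrableOn_fun_norm_addHaar volume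
    (f := fun t : ℝ => t ^ (1 - (finrank ℝ E : ℝ)))).2 ?_
  have hd : 1 ≤ finrank ℝ E := finrank_pos
  refine IntegrableOn.congr_fun (f := fun _ => (1 : ℝ))
    (integrableOn_const (by simp) (by simp)) (fun t ht => ?_) measurableSet_Ioo
  have ht : 0 < t := ht.1
  simp only [smul_eq_mul]
  rw [← Real.rpow_natCast, ← Real.rpow_add ht, Nat.cast_sub hd]
  simp

theorem aestronglyMeasurable_newtonKernel {ε : ℝ} (hε : 0 ≤ ε) :
    AEStronglyMeasurable (newtonKernel E ε) volume := by
  rw [← restrict_compl_singleton (μ := (volume : Measure E)) 0]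
  refine ContinuousOn.aestronglyMeasurable (fun y hy => ?_) (measurableSet_singleton _).compl
  have : 0 < ‖y‖ := norm_pos_iff.2 hy
  exact (contDiffAt_newtonKernel (by positivity)).continuousAt.continuousWithinAt

theorem ae_ne_zero : ∀ᵐ y : E, y ≠ 0 := by
  simp [ae_iff]

theorem locallyIntegrable_newtonKernelBound :
    LocallyIntegrable (fun y : E => ‖y‖ ^ 2 + 1 + ‖y‖ ^ (1 - (finrank ℝ E : ℝ))) volume :=
  (Continuous.locallyIntegrable (by fun_prop)).add locallyIntegrable_norm_rpow_one_sub_finrank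

theorem locallyIntegrable_newtonKernel :
    LocallyIntegrable (newtonKernel E 0) volume := by
  refine locallyIntegrable_newtonKernelBound.mono (aestronglyMeasurable_newtonKernel le_rfl) ?_
  filter_upwards [ae_ne_zero] with y hy
  exact (abs_newtonKernel_le le_rfl zero_le_one hy).trans (le_abs_self _)

theorem locallyIntegrable_newtonWeight_mul_inner (v : E) :
    LocallyIntegrable (fun y => newtonWeight E 0 y * inner ℝ y v) volume := by
  refine (locallyIntegrable_norm_rpow_one_sub_finrank.smul ‖v‖).mono
    (((measurable_newtonWeight 0).mul (by fun_prop)).aestronglyMeasurable) ?_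
  filter_upwards [ae_ne_zero] with y hy
  rw [norm_mul, Real.norm_of_nonneg (newtonWeight_nonneg le_rfl y)]
  calc newtonWeight E 0 y * ‖inner ℝ y v‖ ≤ newtonWeight E 0 y * (‖y‖ * ‖v‖) :=
        mul_le_mul_of_nonneg_left (norm_inner_le_norm y v) (newtonWeight_nonneg le_rfl y)
    _ ≤ ‖y‖ ^ (1 - (finrank ℝ E : ℝ)) * ‖v‖ := by
        rw [← mul_assoc]
        exact mul_le_mul_of_nonneg_right (newtonWeight_mul_norm_le le_rfl hy) (norm_nonneg _)
    _ ≤ _ := by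
        rw [mul_comm]
        exact le_abs_self _

end Kernel

/-! ### Distributional gradient and Laplacian of the kernel, as limits `ε → 0`. -/

section Limits

variable {E : Type*} [NormedAddCommGroup E] [InnerProductSpace ℝ E]
  [MeasurableSpace E] [BorelSpace E] [FiniteDimensional ℝ E]

/-- Integration by parts against a compactly supported function. -/
theorem integral_mul_fderiv_eq_neg_of_hasCompactSupport {f h : E → ℝ} {f' : E → E →L[ℝ] ℝ}
    (hf : ∀ y, HasFDerivAt f (f' y) y) (v : E) (hf' : Continuous fun y => f' y v)
    (hh : ContDiff ℝ 1 h) (hs : HasCompactSupport h) :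
    ∫ y, f y * fderiv ℝ h y v = -∫ y, f' y v * h y := by
  have hfc : Continuous f := continuous_iff_continuousAt.2 fun y => (hf y).continuousAt
  have hd : Continuous fun y => fderiv ℝ h y v :=
    (hh.continuous_fderiv one_ne_zero).clm_apply continuous_const
  exact integral_bilinear_hasFDerivAt_right_eq_neg_left_of_integrable
    (B := ContinuousLinearMap.mul ℝ ℝ)
    ((hf'.mul hh.continuous).integrable_of_hasCompactSupport hs.mul_left)
    ((hfc.mul hd).integrable_of_hasCompactSupport (hs.fderiv_apply ℝ v).mul_left)
    ((hfc.mul hh.continuous).integrable_of_hasCompactSupport hs.mul_left)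
    (fun y _ => hf y) (fun y _ => (hh.differentiable one_ne_zero y).hasFDerivAt)

/-- The mass of the Laplacian of the fundamental solution. -/
noncomputable def newtonMass (E : Type*) [NormedAddCommGroup E] [InnerProductSpace ℝ E]
    [MeasurableSpace E] [BorelSpace E] [FiniteDimensional ℝ E] : ℝ :=
  ∫ z : E, finrank ℝ E * (1 + ‖z‖ ^ 2) ^ (-((finrank ℝ E : ℝ) + 2) / 2)

theorem integrable_newtonMass : Integrable
    (fun z : E => finrank ℝ E * (1 + ‖z‖ ^ 2) ^ (-((finrank ℝ E : ℝ) + 2) / 2)) :=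
  (integrable_rpow_neg_one_add_norm_sq (by linarith)).const_mul _

/-- Expanding `y` in an orthonormal basis turns the left side into the pairing of the kernel's
gradient with that of `h`; integration by parts in each direction produces the Laplacian of the
regularised kernel. -/
theorem integral_newtonWeight_mul_fderiv_self {ε : ℝ} (hε : 0 < ε) {h : E → ℝ}
    (hh : ContDiff ℝ 1 h) (hs : HasCompactSupport h) :
    ∫ y, newtonWeight E ε y * fderiv ℝ h y y =
      -∫ y, finrank ℝ E * ε * (‖y‖ ^ 2 + ε) ^ (-(finrank ℝ E : ℝ) / 2 - 1) * h y := by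
  let b := stdOrthonormalBasis ℝ E
  have hpos : ∀ y : E, 0 < ‖y‖ ^ 2 + ε := fun y => by positivity
  have hw := continuous_newtonWeight (E := E) hε
  have hin : ∀ v : E, Continuous fun y : E => inner ℝ y v := fun v => by fun_prop
  have hp : Continuous fun y : E => (‖y‖ ^ 2 + ε) ^ (-(finrank ℝ E : ℝ) / 2 - 1) :=
    Continuous.rpow_const (by fun_prop) fun y => Or.inl (hpos y).ne'
  have hd : ∀ v, Continuous fun y => fderiv ℝ h y v := fun v =>
    (hh.continuous_fderiv one_ne_zero).clm_apply continuous_const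
  have hf' : ∀ v : E, Continuous fun y => (newtonWeight E ε y • innerSL ℝ v + inner ℝ y v •
      ((-(finrank ℝ E : ℝ) * (‖y‖ ^ 2 + ε) ^ (-(finrank ℝ E : ℝ) / 2 - 1)) • innerSL ℝ y)) v :=
    fun v => (hw.mul continuous_const).add ((hin v).mul ((continuous_const.mul hp).mul (hin v)))
  calc ∫ y, newtonWeight E ε y * fderiv ℝ h y y
      = ∫ y, ∑ i, newtonWeight E ε y * inner ℝ y (b i) * fderiv ℝ h y (b i) := by
        refine integral_congr_ae (ae_of_all _ fun y => ?_)
        dsimp only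
        conv_lhs => rw [← congrArg (fderiv ℝ h y) (b.sum_repr y), map_sum, Finset.mul_sum]
        refine Finset.sum_congr rfl fun i _ => ?_
        rw [map_smul, b.repr_apply_apply, real_inner_comm, smul_eq_mul, mul_assoc]
    _ = ∑ i, ∫ y, newtonWeight E ε y * inner ℝ y (b i) * fderiv ℝ h y (b i) :=
        integral_finsetSum _ fun i _ =>
          ((hw.mul (hin _)).mul (hd _)).integrable_of_hasCompactSupport
            (hs.fderiv_apply ℝ _).mul_left
    _ = ∑ i, -∫ y, (newtonWeight E ε y • innerSL ℝ (b i) + inner ℝ y (b i) •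
        ((-(finrank ℝ E : ℝ) * (‖y‖ ^ 2 + ε) ^ (-(finrank ℝ E : ℝ) / 2 - 1)) • innerSL ℝ y))
          (b i) * h y :=
        Finset.sum_congr rfl fun i _ => integral_mul_fderiv_eq_neg_of_hasCompactSupport
          (fun y => hasFDerivAt_newtonWeight_mul_inner (hpos y) (b i)) (b i) (hf' _) hh hs
    _ = _ := by
        have hint : ∀ i, Integrable fun y => (newtonWeight E ε y • innerSL ℝ (b i) +
            inner ℝ y (b i) • ((-(finrank ℝ E : ℝ) * (‖y‖ ^ 2 + ε) ^
              (-(finrank ℝ E : ℝ) / 2 - 1)) • innerSL ℝ y)) (b i) * h y := fun i =>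
          ((hf' (b i)).mul hh.continuous).integrable_of_hasCompactSupport hs.mul_left
        rw [Finset.sum_neg_distrib, ← integral_finsetSum _ fun i _ => hint i]
        simp_rw [← Finset.sum_mul]
        congr 2
        ext y
        rw [sum_newtonWeight_second_derivative b (hpos y)]

/-- The Laplacians are an approximate identity: the substitution `y = δ z` makes the density
independent of `δ`, and `h (δ • z)` tends boundedly to `h 0`. -/
theorem tendsto_integral_laplacian_newtonKernel_mul {h : E → ℝ} (hh : Continuous h)
    (hs : HasCompactSupport h) :
    Tendsto (fun δ : ℝ => ∫ y, finrank ℝ E * δ ^ 2 *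
      (‖y‖ ^ 2 + δ ^ 2) ^ (-(finrank ℝ E : ℝ) / 2 - 1) * h y) (𝓝[>] 0)
      (𝓝 (newtonMass E * h 0)) := by
  obtain ⟨C, hC⟩ := hh.bounded_above_of_compact_support hs
  have key : Tendsto (fun δ : ℝ => ∫ z : E, finrank ℝ E *
      (1 + ‖z‖ ^ 2) ^ (-((finrank ℝ E : ℝ) + 2) / 2) * h (δ • z)) (𝓝[>] 0)
      (𝓝 (newtonMass E * h 0)) := by
    rw [newtonMass, ← integral_mul_const]
    refine tendsto_integral_filter_of_dominated_convergence (fun z : E => finrank ℝ E *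
      (1 + ‖z‖ ^ 2) ^ (-((finrank ℝ E : ℝ) + 2) / 2) * C) ?_ ?_
      (integrable_newtonMass.mul_const C) ?_
    · exact Eventually.of_forall fun δ => integrable_newtonMass.aestronglyMeasurable.mul
        (by fun_prop : Continuous fun z => h (δ • z)).aestronglyMeasurable
    · refine Eventually.of_forall fun δ => ae_of_all _ fun z => ?_
      have : 0 ≤ finrank ℝ E * (1 + ‖z‖ ^ 2) ^ (-((finrank ℝ E : ℝ) + 2) / 2) := by positivity
      rw [norm_mul, Real.norm_of_nonneg this]
      exact mul_le_mul_of_nonneg_left (hC _) this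
    · refine ae_of_all _ fun z => Tendsto.const_mul _ ?_
      have : Continuous fun δ : ℝ => h (δ • z) := by fun_prop
      simpa using (this.tendsto 0).mono_left nhdsWithin_le_nhds
  refine key.congr' ?_
  filter_upwards [self_mem_nhdsWithin] with δ hδ
  have hδ : 0 < δ := hδ
  have h1 := Measure.integral_comp_smul_of_nonneg (volume : Measure E) (fun y => finrank ℝ E * δ ^ 2 *
      (‖y‖ ^ 2 + δ ^ 2) ^ (-(finrank ℝ E : ℝ) / 2 - 1) * h y) δ (hR := hδ.le)
  rw [smul_eq_mul, inv_mul_eq_div, eq_div_iff (by positivity), ← integral_mul_const] at h1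
  rw [← h1]
  refine integral_congr_ae (ae_of_all _ fun z => ?_)
  dsimp only
  -- The power `δ^(-d-2)` produced here absorbs the Jacobian `δ^d` and the prefactor `δ²`.
  have h2 : (‖δ • z‖ ^ 2 + δ ^ 2) ^ (-(finrank ℝ E : ℝ) / 2 - 1) =
      (1 + ‖z‖ ^ 2) ^ (-((finrank ℝ E : ℝ) + 2) / 2) * (δ ^ finrank ℝ E * δ ^ 2)⁻¹ := by
    rw [norm_smul, Real.norm_of_nonneg hδ.le,
      show (δ * ‖z‖) ^ 2 + δ ^ 2 = (1 + ‖z‖ ^ 2) * δ ^ 2 by ring,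
      Real.mul_rpow (by positivity) (by positivity), ← pow_add, ← Real.rpow_natCast δ 2,
      ← Real.rpow_mul hδ.le, ← Real.rpow_natCast δ (_ + 2), ← Real.rpow_neg hδ.le]
    congr 2
    · ring
    · push_cast; ring
  rw [h2]
  field_simp

variable [Nontrivial E]

/-- Positivity is all that is needed of this constant: it is divided out in `exists_laplacian_eq`.
-/
theorem newtonMass_pos : 0 < newtonMass E := by
  have hd : (0 : ℝ) < finrank ℝ E := by exact_mod_cast finrank_pos
  have hpos : ∀ z : E, 0 < finrank ℝ E * (1 + ‖z‖ ^ 2) ^ (-((finrank ℝ E : ℝ) + 2) / 2) :=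
    fun z => by positivity
  refine (integral_pos_iff_support_of_nonneg (fun z => (hpos z).le) integrable_newtonMass).2 ?_
  rw [show Function.support _ = (univ : Set E) from eq_univ_of_forall fun z => (hpos z).ne']
  simp

theorem tendsto_integral_newtonKernel_mul {k : E → ℝ} (hk : Continuous k)
    (hks : HasCompactSupport k) :
    Tendsto (fun ε : ℝ => ∫ y, newtonKernel E ε y * k y) (𝓝[>] 0)
      (𝓝 (∫ y, newtonKernel E 0 y * k y)) := by
  have hI : ∀ᶠ ε : ℝ in 𝓝[>] 0, 0 < ε ∧ ε ≤ 1 := by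
    filter_upwards [Ioc_mem_nhdsGT (zero_lt_one (α := ℝ))] with ε hε using hε
  refine tendsto_integral_filter_of_dominated_convergence
    (fun y => (‖y‖ ^ 2 + 1 + ‖y‖ ^ (1 - (finrank ℝ E : ℝ))) * ‖k y‖) ?_ ?_ ?_ ?_
  · filter_upwards [hI] with ε hε
    exact (aestronglyMeasurable_newtonKernel hε.1.le).mul hk.aestronglyMeasurable
  · filter_upwards [hI] with ε hε
    filter_upwards [ae_ne_zero] with y hy
    rw [norm_mul]
    exact mul_le_mul_of_nonneg_right (abs_newtonKernel_le hε.1.le hε.2 hy) (norm_nonneg _)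
  · exact locallyIntegrable_newtonKernelBound.integrable_smul_right_of_hasCompactSupport
      hk.norm hks.norm
  · filter_upwards [ae_ne_zero] with y hy
    have hy' : 0 < ‖y‖ := norm_pos_iff.2 hy
    refine Tendsto.mul_const _ ?_
    have hc : ContinuousAt (fun ε : ℝ => newtonKernel E ε y) 0 := by
      refine ContinuousAt.comp (f := fun ε : ℝ => ‖y‖ ^ 2 + ε) ?_ (by fun_prop)
      exact (hasDerivAt_newtonProfile _ (by positivity)).continuousAt
    exact hc.tendsto.mono_left nhdsWithin_le_nhds

/-- The weight `‖y‖^(-d)` alone is not locally integrable; the factor `‖y‖` in the bound on `k`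
lowers the singularity to `‖y‖^(1-d)`, which dominates uniformly in `ε`. -/
theorem tendsto_integral_newtonWeight_mul {k m : E → ℝ} (hk : Continuous k)
    (hm : Continuous m) (hms : HasCompactSupport m) (hkm : ∀ y, ‖k y‖ ≤ ‖y‖ * m y) :
    Tendsto (fun ε : ℝ => ∫ y, newtonWeight E ε y * k y) (𝓝[>] 0)
      (𝓝 (∫ y, newtonWeight E 0 y * k y)) := by
  refine tendsto_integral_filter_of_dominated_convergence
    (fun y => ‖y‖ ^ (1 - (finrank ℝ E : ℝ)) * m y) ?_ ?_ ?_ ?_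
  · exact Eventually.of_forall fun ε =>
      ((measurable_newtonWeight ε).mul hk.measurable).aestronglyMeasurable
  · filter_upwards [self_mem_nhdsWithin] with ε hε
    have hε : 0 < ε := hε
    filter_upwards [ae_ne_zero] with y hy
    have hy' : 0 < ‖y‖ := norm_pos_iff.2 hy
    have hm0 : 0 ≤ m y := nonneg_of_mul_nonneg_right ((norm_nonneg _).trans (hkm y)) hy'
    rw [norm_mul, Real.norm_of_nonneg (newtonWeight_nonneg hε.le y)]
    calc newtonWeight E ε y * ‖k y‖ ≤ newtonWeight E ε y * (‖y‖ * m y) :=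
          mul_le_mul_of_nonneg_left (hkm y) (newtonWeight_nonneg hε.le y)
      _ ≤ _ := by
          rw [← mul_assoc]
          exact mul_le_mul_of_nonneg_right (newtonWeight_mul_norm_le hε.le hy) hm0
  · exact locallyIntegrable_norm_rpow_one_sub_finrank.integrable_smul_right_of_hasCompactSupport
      hm hms
  · filter_upwards [ae_ne_zero] with y hy
    have hy' : 0 < ‖y‖ := norm_pos_iff.2 hy
    refine Tendsto.mul_const _ ?_
    have hc : ContinuousAt (fun ε : ℝ => newtonWeight E ε y) 0 :=
      ContinuousAt.rpow_const (by fun_prop) (Or.inl (by positivity))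
    exact hc.tendsto.mono_left nhdsWithin_le_nhds

/-- Integration by parts against the fundamental solution. -/
theorem integral_newtonKernel_mul_fderiv {h : E → ℝ} (hh : ContDiff ℝ 1 h)
    (hs : HasCompactSupport h) (v : E) :
    ∫ y, newtonKernel E 0 y * fderiv ℝ h y v = -∫ y, newtonWeight E 0 y * (inner ℝ y v * h y) := by
  have hd : Continuous fun y => fderiv ℝ h y v :=
    (hh.continuous_fderiv one_ne_zero).clm_apply continuous_const
  have h1 := tendsto_integral_newtonKernel_mul hd (hs.fderiv_apply ℝ v)
  have h2 := (tendsto_integral_newtonWeight_mul (k := fun y => inner ℝ y v * h y)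
    (m := fun y => ‖v‖ * ‖h y‖) ((by fun_prop : Continuous fun y : E => inner ℝ y v).mul
      hh.continuous) (continuous_const.mul hh.continuous.norm) hs.norm.mul_left (fun y => by
        rw [norm_mul, ← mul_assoc]
        exact mul_le_mul_of_nonneg_right (norm_inner_le_norm y v) (norm_nonneg _))).neg
  refine tendsto_nhds_unique (h1.congr' ?_) h2
  filter_upwards [self_mem_nhdsWithin] with ε hε
  have hε : 0 < ε := hε
  rw [integral_mul_fderiv_eq_neg_of_hasCompactSupport
    (fun y => hasFDerivAt_newtonKernel (by positivity)) v
    ((continuous_newtonWeight hε).mul (by fun_prop : Continuous fun y : E => inner ℝ y v)) hh hs]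
  simp [mul_assoc]

/-- The fundamental solution has distributional Laplacian a multiple of the Dirac mass. -/
theorem integral_newtonWeight_zero_mul_fderiv_self {h : E → ℝ}
    (hh : ContDiff ℝ 1 h) (hs : HasCompactSupport h) :
    ∫ y, newtonWeight E 0 y * fderiv ℝ h y y = -(newtonMass E * h 0) := by
  have hd := hh.continuous_fderiv one_ne_zero
  have h1 := tendsto_integral_newtonWeight_mul (k := fun y => fderiv ℝ h y y)
    (m := fun y => ‖fderiv ℝ h y‖) (hd.clm_apply continuous_id) hd.norm (hs.fderiv ℝ).norm
    (fun y => by rw [mul_comm]; exact (fderiv ℝ h y).le_opNorm y)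
  -- The regularisation parameter is `ε = δ²`, matching the scaling `y = δ z`.
  have h3 : Tendsto (fun δ : ℝ => δ ^ 2) (𝓝[>] 0) (𝓝[>] 0) := by
    refine tendsto_nhdsWithin_iff.2 ⟨?_, ?_⟩
    · have : Continuous fun δ : ℝ => δ ^ 2 := by fun_prop
      simpa using (this.tendsto 0).mono_left nhdsWithin_le_nhds
    · filter_upwards [self_mem_nhdsWithin] with δ hδ using pow_pos (show (0 : ℝ) < δ from hδ) 2
  refine tendsto_nhds_unique ((h1.comp h3).congr' ?_)
    (tendsto_integral_laplacian_newtonKernel_mul hh.continuous hs).neg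
  filter_upwards [self_mem_nhdsWithin] with δ hδ
  exact integral_newtonWeight_mul_fderiv_self (pow_pos (show (0 : ℝ) < δ from hδ) 2) hh hs

end Limits

open scoped Convolution

/-! ### Newtonian potentials and the solution of Poisson's equation. -/

section Poisson

theorem fderiv_fderiv_apply {E : Type*} [NormedAddCommGroup E] [NormedSpace ℝ E] {V : E → ℝ} {x : E} (hV : ContDiffAt ℝ 2 V x) (v w : E) :
    fderiv ℝ (fun z => fderiv ℝ V z v) x w = fderiv ℝ (fderiv ℝ V) x w v := by
  have hd : DifferentiableAt ℝ (fderiv ℝ V) x :=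
    (hV.fderiv_right (m := 1) (by norm_num)).differentiableAt one_ne_zero
  rw [fderiv_clm_apply hd (differentiableAt_const _)]
  simp

theorem laplacian_eq_sum_fderiv_fderiv {E ι : Type*} [NormedAddCommGroup E]
    [InnerProductSpace ℝ E] [FiniteDimensional ℝ E] [Fintype ι]
    (b : OrthonormalBasis ι ℝ E) (V : E → ℝ) (x : E) :
    Laplacian.laplacian V x = ∑ i, fderiv ℝ (fderiv ℝ V) x (b i) (b i) := by
  rw [InnerProductSpace.laplacian_eq_iteratedFDeriv_orthonormalBasis V b]
  simp [iteratedFDeriv_two_apply]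

theorem laplacian_eq_sum_fderiv {E ι : Type*} [NormedAddCommGroup E] [InnerProductSpace ℝ E]
    [FiniteDimensional ℝ E] [Fintype ι] (b : OrthonormalBasis ι ℝ E) {V : E → ℝ} {x : E}
    (hV : ContDiffAt ℝ 2 V x) :
    Laplacian.laplacian V x = ∑ i, fderiv ℝ (fun z => fderiv ℝ V z (b i)) x (b i) := by
  rw [laplacian_eq_sum_fderiv_fderiv b]
  exact Finset.sum_congr rfl fun i _ => (fderiv_fderiv_apply hV _ _).symm

theorem hasFDerivAt_comp_const_sub {E : Type*} [NormedAddCommGroup E] [NormedSpace ℝ E]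
    {g : E → ℝ} (hg : Differentiable ℝ g) (x y : E) :
    HasFDerivAt (fun z => g (x - z)) (-fderiv ℝ g (x - y)) y := by
  have h1 : HasFDerivAt (fun z : E => x - z) (-ContinuousLinearMap.id ℝ E) y :=
    (hasFDerivAt_id y).const_sub x
  have h2 := (hg (x - y)).hasFDerivAt.comp y h1
  exact h2.congr_fderiv (by ext; simp)

theorem hasCompactSupport_comp_const_sub {E : Type*} [NormedAddCommGroup E]
    {g : E → ℝ} (hs : HasCompactSupport g) (x : E) :
    HasCompactSupport fun z => g (x - z) :=
  hs.comp_homeomorph (Homeomorph.subLeft x)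

theorem laplacian_newtonKernel {E : Type*} [NormedAddCommGroup E] [InnerProductSpace ℝ E]
    [FiniteDimensional ℝ E] {y : E} (hy : y ≠ 0) :
    Laplacian.laplacian (newtonKernel E 0) y = 0 := by
  let b := stdOrthonormalBasis ℝ E
  have hy' : 0 < ‖y‖ := norm_pos_iff.2 hy
  have hpos : 0 < ‖y‖ ^ 2 + 0 := by positivity
  rw [laplacian_eq_sum_fderiv b (contDiffAt_infty.1 (contDiffAt_newtonKernel hpos) 2)]
  have h1 : ∀ i, fderiv ℝ (fun z => fderiv ℝ (newtonKernel E 0) z (b i)) y =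
      fderiv ℝ (fun z => newtonWeight E 0 z * inner ℝ z (b i)) y := by
    intro i
    refine Filter.EventuallyEq.fderiv_eq ?_
    filter_upwards [isOpen_ne.mem_nhds hy] with z hz
    have hz' : 0 < ‖z‖ := norm_pos_iff.2 hz
    rw [(hasFDerivAt_newtonKernel (by positivity)).fderiv]
    simp
  simp_rw [h1, (hasFDerivAt_newtonWeight_mul_inner hpos _).fderiv]
  rw [sum_newtonWeight_second_derivative b hpos]
  simp

variable {E : Type*} [NormedAddCommGroup E] [InnerProductSpace ℝ E]
  [MeasurableSpace E] [BorelSpace E] [FiniteDimensional ℝ E]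

theorem fderiv_convolution_mul_apply {f g : E → ℝ} (hf : LocallyIntegrable f volume)
    (hg : ContDiff ℝ 1 g) (hs : HasCompactSupport g) (x v : E) :
    fderiv ℝ (f ⋆[ContinuousLinearMap.mul ℝ ℝ, volume] g) x v =
      (f ⋆[ContinuousLinearMap.mul ℝ ℝ, volume] fun y => fderiv ℝ g y v) x := by
  rw [(hs.hasFDerivAt_convolution_right _ hf hg x).fderiv,
    convolution_precompR_apply _ hf (hs.fderiv ℝ) (hg.continuous_fderiv one_ne_zero)]

theorem laplacian_convolution {f g : E → ℝ} (hf : LocallyIntegrable f volume)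
    (hg : ContDiff ℝ 2 g) (hs : HasCompactSupport g) (x : E) :
    Laplacian.laplacian (f ⋆[ContinuousLinearMap.mul ℝ ℝ, volume] g) x =
      ∫ t, f t * (Laplacian.laplacian g : E → ℝ) (x - t) := by
  let b := stdOrthonormalBasis ℝ E
  have hd : ∀ v, ContDiff ℝ 1 fun y => fderiv ℝ g y v := fun v =>
    (hg.fderiv_right (m := 1) (by norm_num)).clm_apply contDiff_const
  rw [laplacian_eq_sum_fderiv b (hs.contDiff_convolution_right (n := 2) _ hf hg).contDiffAt]
  have h1 : ∀ i, fderiv ℝ (fun z =>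
      fderiv ℝ (f ⋆[ContinuousLinearMap.mul ℝ ℝ, volume] g) z (b i)) x (b i) =
      ∫ t, f t * fderiv ℝ (fun y => fderiv ℝ g y (b i)) (x - t) (b i) := by
    intro i
    simp_rw [fderiv_convolution_mul_apply hf (hg.of_le one_le_two) hs]
    exact fderiv_convolution_mul_apply hf (hd _) (hs.fderiv_apply ℝ _) x (b i)
  have h2 : ∀ i, Integrable fun t =>
      f t * fderiv ℝ (fun y => fderiv ℝ g y (b i)) (x - t) (b i) := fun i =>
    ((hs.fderiv_apply ℝ (b i)).fderiv_apply ℝ (b i)).convolutionExists_right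
      (ContinuousLinearMap.mul ℝ ℝ) hf
      (((hd (b i)).continuous_fderiv one_ne_zero).clm_apply continuous_const) x
  rw [Finset.sum_congr rfl fun i _ => h1 i, ← integral_finsetSum _ fun i _ => h2 i]
  refine integral_congr_ae (ae_of_all _ fun t => ?_)
  dsimp only
  rw [laplacian_eq_sum_fderiv b hg.contDiffAt, Finset.mul_sum]

variable [Nontrivial E]

/-- One derivative moves from `g` to the kernel, whose gradient is still locally integrable. This is
the source of the extra order of regularity of the potential. -/
theorem fderiv_newtonKernel_convolution {g : E → ℝ} (hg : ContDiff ℝ 1 g)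
    (hs : HasCompactSupport g) (x v : E) :
    fderiv ℝ (newtonKernel E 0 ⋆[ContinuousLinearMap.mul ℝ ℝ, volume] g) x v =
      ((fun y => newtonWeight E 0 y * inner ℝ y v)
        ⋆[ContinuousLinearMap.mul ℝ ℝ, volume] g) x := by
  rw [fderiv_convolution_mul_apply locallyIntegrable_newtonKernel hg hs]
  have h := integral_newtonKernel_mul_fderiv (hg.comp (contDiff_const.sub contDiff_id))
    (hasCompactSupport_comp_const_sub hs x) v
  have hf : ∀ y, fderiv ℝ (fun z => g (x - z)) y = -fderiv ℝ g (x - y) := fun y =>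
    (hasFDerivAt_comp_const_sub (hg.differentiable one_ne_zero) x y).fderiv
  simp only [Function.comp_def, id, hf] at h
  simp only [neg_apply, mul_neg, integral_neg, neg_inj] at h
  simpa [convolution_def, mul_assoc] using h

theorem contDiff_newtonKernel_convolution {g : E → ℝ} (hg : ContDiff ℝ 2 g)
    (hs : HasCompactSupport g) :
    ContDiff ℝ 3 (newtonKernel E 0 ⋆[ContinuousLinearMap.mul ℝ ℝ, volume] g) := by
  have h2 := hs.contDiff_convolution_right (n := 2) (ContinuousLinearMap.mul ℝ ℝ)
    (locallyIntegrable_newtonKernel (E := E)) hg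
  rw [show (3 : WithTop ℕ∞) = 2 + 1 by norm_num, contDiff_succ_iff_fderiv_apply]
  refine ⟨h2.differentiable two_ne_zero, by simp, fun v => ?_⟩
  simp_rw [fderiv_newtonKernel_convolution (hg.of_le one_le_two) hs]
  exact hs.contDiff_convolution_right (n := 2) _ (locallyIntegrable_newtonWeight_mul_inner v) hg

/-- A second derivative on the kernel would not be locally integrable, so one falls on the kernel
and the other on `g`. The sum is then the distributional Laplacian of the kernel tested against `z ↦
g (x - z)`. -/
theorem laplacian_newtonKernel_convolution {g : E → ℝ} (hg : ContDiff ℝ 2 g)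
    (hs : HasCompactSupport g) (x : E) :
    Laplacian.laplacian (newtonKernel E 0 ⋆[ContinuousLinearMap.mul ℝ ℝ, volume] g) x =
      newtonMass E * g x := by
  let b := stdOrthonormalBasis ℝ E
  have hg1 : ContDiff ℝ 1 g := hg.of_le one_le_two
  rw [laplacian_eq_sum_fderiv b
    ((contDiff_newtonKernel_convolution hg hs).of_le (by norm_num)).contDiffAt]
  have h1 : ∀ i, fderiv ℝ (fun z => fderiv ℝ
      (newtonKernel E 0 ⋆[ContinuousLinearMap.mul ℝ ℝ, volume] g) z (b i)) x (b i) =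
      ∫ y, newtonWeight E 0 y * inner ℝ y (b i) * fderiv ℝ g (x - y) (b i) := by
    intro i
    simp_rw [fderiv_newtonKernel_convolution hg1 hs]
    exact fderiv_convolution_mul_apply (locallyIntegrable_newtonWeight_mul_inner _) hg1 hs x (b i)
  have h2 : ∀ i, Integrable fun y =>
      newtonWeight E 0 y * inner ℝ y (b i) * fderiv ℝ g (x - y) (b i) := fun i =>
    (hs.fderiv_apply ℝ (b i)).convolutionExists_right
      (ContinuousLinearMap.mul ℝ ℝ) (locallyIntegrable_newtonWeight_mul_inner _)
      ((hg1.continuous_fderiv one_ne_zero).clm_apply continuous_const) x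
  rw [Finset.sum_congr rfl fun i _ => h1 i, ← integral_finsetSum _ fun i _ => h2 i]
  have h3 := integral_newtonWeight_zero_mul_fderiv_self
    (hg1.comp (contDiff_const.sub contDiff_id)) (hasCompactSupport_comp_const_sub hs x)
  have hf : ∀ y, fderiv ℝ (fun z => g (x - z)) y = -fderiv ℝ g (x - y) := fun y =>
    (hasFDerivAt_comp_const_sub (hg1.differentiable one_ne_zero) x y).fderiv
  simp only [Function.comp_def, id, hf] at h3
  simp only [neg_apply, mul_neg, integral_neg, neg_inj, sub_zero] at h3
  rw [← h3]
  refine integral_congr_ae (ae_of_all _ fun y => ?_)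
  dsimp only
  conv_rhs => rw [← congrArg (fderiv ℝ g (x - y)) (b.sum_repr y), map_sum, Finset.mul_sum]
  refine Finset.sum_congr rfl fun i _ => ?_
  rw [map_smul, b.repr_apply_apply, real_inner_comm, smul_eq_mul, mul_assoc]

theorem integrable_newtonKernel_sub_mul {f : E → ℝ} (hf : AEStronglyMeasurable f volume)
    {C R : ℝ} (hC : ∀ t, ‖f t‖ ≤ C) (hR : ∀ t, f t ≠ 0 → ‖t‖ ≤ R) (x : E) :
    Integrable fun t => newtonKernel E 0 (x - t) * f t := by
  have h1 : Integrable (fun t => newtonKernel E 0 t * f (x - t)) := by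
    rw [← integrableOn_iff_integrable_of_support_subset (s := Metric.closedBall x R)]
    · refine Integrable.mul_bdd (c := C) (locallyIntegrable_newtonKernel.integrableOn_isCompact
        (isCompact_closedBall x R)) ?_ (ae_of_all _ fun t => hC _)
      exact (hf.comp_quasiMeasurePreserving
        (quasiMeasurePreserving_sub_left volume x)).restrict
    · intro t ht
      have := hR (x - t) (right_ne_zero_of_mul ht)
      rwa [Metric.mem_closedBall, dist_comm, dist_eq_norm]
  simpa using h1.comp_sub_left x

/-- Poisson's equation is solvable on a bounded open set for bounded data. -/
theorem exists_laplacian_eq_newtonMass_mul {Ω : Set E} (hΩ : IsOpen Ω)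
    (hb : Bornology.IsBounded Ω) {g : E → ℝ} (hg : ContDiffOn ℝ 2 g Ω) {C : ℝ}
    (hC : ∀ x ∈ Ω, ‖g x‖ ≤ C) :
    ∃ V : E → ℝ, ContDiffOn ℝ 3 V Ω ∧
      ∀ x ∈ Ω, Laplacian.laplacian V x = newtonMass E * g x := by
  obtain ⟨R, hR0, hR⟩ := hb.exists_pos_norm_le
  -- The extension by zero may jump across the boundary, so regularity of the potential is proved
  -- locally.
  set f : E → ℝ := Ω.indicator g with hf
  have hfm : AEStronglyMeasurable f volume :=
    (aestronglyMeasurable_indicator_iff hΩ.measurableSet).2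
      (hg.continuousOn.aestronglyMeasurable hΩ.measurableSet)
  have hfR : ∀ t, f t ≠ 0 → t ∈ Ω := fun t ht => mem_of_indicator_ne_zero ht
  have hfC : ∀ t, ‖f t‖ ≤ |C| := by
    intro t
    by_cases ht : t ∈ Ω
    · rw [hf, indicator_of_mem ht]
      exact (hC t ht).trans (le_abs_self C)
    · rw [hf, indicator_of_notMem ht, norm_zero]
      exact abs_nonneg C
  -- Near `x₀` split `f = χ f + (1 - χ) f`. The first piece is `C²` with compact support. The second
  -- vanishes near `x₀`, so there its potential sees the kernel only away from the singularity: the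
  -- kernel may be replaced by the smooth truncation `k`, and this part is harmonic at `x₀`.
  have key : ∀ x₀ ∈ Ω, ∃ V₁ : E → ℝ, ContDiff ℝ 3 V₁ ∧
      Laplacian.laplacian V₁ x₀ = newtonMass E * g x₀ ∧
      (fun x => ∫ t, newtonKernel E 0 (x - t) * f t) =ᶠ[𝓝 x₀] V₁ := by
    intro x₀ hx₀
    obtain ⟨s, hs0, hs⟩ := Metric.isOpen_iff.1 hΩ x₀ hx₀
    -- If `‖x - x₀‖ < s / 6` and `f₂ t ≠ 0`, then `t` is farther than `s / 3` from `x₀`, so `‖x - t‖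
    -- > s / 6`, where `α` vanishes. Also `‖x - t‖ ≤ 2 * R`, where `β` equals `1`.
    let χ : ContDiffBump x₀ := ⟨s / 3, s / 2, by positivity, by linarith⟩
    let α : ContDiffBump (0 : E) := ⟨s / 12, s / 6, by positivity, by linarith⟩
    let β : ContDiffBump (0 : E) := ⟨2 * R + 1, 2 * R + 2, by positivity, by linarith⟩
    set f₁ : E → ℝ := fun t => χ t * f t with hf₁
    set f₂ : E → ℝ := fun t => (1 - χ t) * f t with hf₂
    set k : E → ℝ := fun y => (1 - α y) * β y * newtonKernel E 0 y with hk
    have hf₁s : HasCompactSupport f₁ := χ.hasCompactSupport.mul_right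
    have hf₁c : ContDiff ℝ 2 f₁ := by
      rw [contDiff_iff_contDiffAt]
      intro t
      by_cases ht : t ∈ Ω
      · have : f =ᶠ[𝓝 t] g := by
          filter_upwards [hΩ.mem_nhds ht] with z hz using indicator_of_mem hz g
        exact χ.contDiff.contDiffAt.mul
          ((hg.contDiffAt (hΩ.mem_nhds ht)).congr_of_eventuallyEq this)
      · have htn : t ∉ tsupport f₁ := fun h => ht (hs (by
          have h' := (closure_mono (Function.support_mul_subset_left _ _)) h
          have : t ∈ tsupport χ := h'
          rw [χ.tsupport_eq] at this
          exact Metric.closedBall_subset_ball (show s / 2 < s by linarith) this))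
        exact (contDiffAt_const (c := (0 : ℝ))).congr_of_eventuallyEq
          (notMem_tsupport_iff_eventuallyEq.1 htn)
    have hχ1 : ∀ t, ‖(1 - χ t : ℝ)‖ ≤ 1 := fun t => by
      rw [Real.norm_eq_abs, abs_le]
      constructor <;> linarith [χ.nonneg' t, χ.le_one (x := t)]
    have hχ2 : ∀ t, ‖(χ t : ℝ)‖ ≤ 1 := fun t => by
      rw [Real.norm_of_nonneg (χ.nonneg' t)]
      exact χ.le_one
    have hf₁m : AEStronglyMeasurable f₁ volume := hf₁c.continuous.aestronglyMeasurable
    have hf₂m : AEStronglyMeasurable f₂ volume :=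
      (continuous_const.sub χ.continuous).aestronglyMeasurable.mul hfm
    have hf₁C : ∀ t, ‖f₁ t‖ ≤ |C| := fun t => by
      rw [hf₁, norm_mul]
      simpa using mul_le_mul (hχ2 t) (hfC t) (norm_nonneg _) zero_le_one
    have hf₂C : ∀ t, ‖f₂ t‖ ≤ |C| := fun t => by
      rw [hf₂, norm_mul]
      simpa using mul_le_mul (hχ1 t) (hfC t) (norm_nonneg _) zero_le_one
    have hf₂i : LocallyIntegrable f₂ volume :=
      (locallyIntegrable_const |C|).mono hf₂m (ae_of_all _ fun t =>
        (hf₂C t).trans (le_abs_self _))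
    have hks : HasCompactSupport k := (β.hasCompactSupport.mul_left).mul_right
    have hkc : ContDiff ℝ (⊤ : ℕ∞) k := by
      rw [contDiff_iff_contDiffAt]
      intro y
      by_cases hy : y = 0
      · subst hy
        refine (contDiffAt_const (c := (0 : ℝ))).congr_of_eventuallyEq ?_
        filter_upwards [α.eventuallyEq_one] with z hz
        have hz : α z = 1 := by simpa using hz
        simp [hk, hz]
      · have hy' : 0 < ‖y‖ := norm_pos_iff.2 hy
        exact ((contDiffAt_const.sub α.contDiffAt).mul β.contDiffAt).mul
          (contDiffAt_newtonKernel (by positivity))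
    have hkeq : ∀ y, s / 6 < ‖y‖ → ‖y‖ < 2 * R + 1 → k y = newtonKernel E 0 y := by
      intro y h1 h2
      have e1 : α y = 0 := α.zero_of_le_dist (by rw [dist_zero_right]; exact h1.le)
      have e2 : β y = 1 := β.one_of_mem_closedBall (by rw [mem_closedBall_zero_iff]; exact h2.le)
      simp [hk, e1, e2]
    have hsep : ∀ x ∈ Metric.ball x₀ (s / 6), ∀ t, f₂ t ≠ 0 →
        s / 6 < ‖x - t‖ ∧ ‖x - t‖ < 2 * R + 1 := by
      intro x hx t ht
      have htΩ := hfR t (right_ne_zero_of_mul ht)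
      have hxΩ : x ∈ Ω := hs (Metric.ball_subset_ball (by linarith) hx)
      have htd : s / 3 < dist t x₀ := by
        by_contra! h
        exact left_ne_zero_of_mul ht (by
          rw [χ.one_of_mem_closedBall (Metric.mem_closedBall.2 h), sub_self])
      rw [Metric.mem_ball] at hx
      have := dist_triangle t x x₀
      rw [dist_comm t x, dist_eq_norm x t] at this
      exact ⟨by linarith, by linarith [norm_sub_le x t, hR x hxΩ, hR t htΩ]⟩
    have h1 := contDiff_newtonKernel_convolution hf₁c hf₁s
    have h2 : ContDiff ℝ 3 (f₂ ⋆[ContinuousLinearMap.mul ℝ ℝ, volume] k) :=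
      hks.contDiff_convolution_right (n := 3) _ hf₂i (contDiff_infty.1 hkc 3)
    refine ⟨(newtonKernel E 0 ⋆[ContinuousLinearMap.mul ℝ ℝ, volume] f₁) +
      (f₂ ⋆[ContinuousLinearMap.mul ℝ ℝ, volume] k), h1.add h2, ?_, ?_⟩
    · rw [(h1.of_le (by norm_num)).contDiffAt.laplacian_add (h2.of_le (by norm_num)).contDiffAt,
        laplacian_newtonKernel_convolution hf₁c hf₁s,
        laplacian_convolution hf₂i (contDiff_infty.1 hkc 2) hks,
        integral_eq_zero_of_ae, add_zero]
      · have : χ x₀ = 1 := χ.one_of_mem_closedBall (Metric.mem_closedBall_self (by positivity))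
        simp [hf₁, this, hf, indicator_of_mem hx₀]
      · refine ae_of_all _ fun t => ?_
        by_cases ht : f₂ t = 0
        · simp [ht]
        · obtain ⟨h3, h4⟩ := hsep x₀ (Metric.mem_ball_self (by positivity)) t ht
          have : k =ᶠ[𝓝 (x₀ - t)] newtonKernel E 0 := by
            filter_upwards [(isOpen_lt continuous_const continuous_norm).mem_nhds h3,
              (isOpen_lt continuous_norm continuous_const).mem_nhds h4] with z hz1 hz2
            exact hkeq z hz1 hz2
          simp only [(InnerProductSpace.laplacian_congr_nhds this).eq_of_nhds]
          rw [laplacian_newtonKernel (norm_pos_iff.1 (by linarith)), mul_zero]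
          rfl
    · filter_upwards [Metric.ball_mem_nhds x₀ (show 0 < s / 6 by positivity)] with x hx
      rw [Pi.add_apply, convolution_mul_swap]
      have i1 := integrable_newtonKernel_sub_mul hf₁m hf₁C
        (fun t ht => hR t (hfR t (right_ne_zero_of_mul ht))) x
      have i2 := integrable_newtonKernel_sub_mul hf₂m hf₂C
        (fun t ht => hR t (hfR t (right_ne_zero_of_mul ht))) x
      have e2 : (f₂ ⋆[ContinuousLinearMap.mul ℝ ℝ, volume] k) x =
          ∫ t, newtonKernel E 0 (x - t) * f₂ t := by
        rw [convolution_def]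
        refine integral_congr_ae (ae_of_all _ fun t => ?_)
        dsimp only
        rw [ContinuousLinearMap.mul_apply', mul_comm]
        by_cases ht : f₂ t = 0
        · simp [ht]
        · rw [hkeq _ (hsep x hx t ht).1 (hsep x hx t ht).2]
      rw [e2, ← integral_add i1 i2]
      refine integral_congr_ae (ae_of_all _ fun t => ?_)
      simp only [hf₁, hf₂]
      ring
  refine ⟨fun x => ∫ t, newtonKernel E 0 (x - t) * f t, fun x hx => ?_, fun x hx => ?_⟩
  · obtain ⟨V₁, h1, -, h3⟩ := key x hx
    exact (h1.contDiffAt.congr_of_eventuallyEq h3).contDiffWithinAt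
  · obtain ⟨V₁, -, h2, h3⟩ := key x hx
    rw [← h2, (InnerProductSpace.laplacian_congr_nhds h3).eq_of_nhds]

/-- Poisson's equation `ΔV = g` has a `C³` solution on a bounded open set when `g` is bounded and
of class `C²`. -/
theorem exists_laplacian_eq {Ω : Set E} (hΩ : IsOpen Ω)
    (hb : Bornology.IsBounded Ω) {g : E → ℝ} (hg : ContDiffOn ℝ 2 g Ω) {C : ℝ}
    (hC : ∀ x ∈ Ω, ‖g x‖ ≤ C) :
    ∃ V : E → ℝ, ContDiffOn ℝ 3 V Ω ∧ ∀ x ∈ Ω, Laplacian.laplacian V x = g x := by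
  have hm := newtonMass_pos (E := E)
  obtain ⟨V, hV, hΔ⟩ := exists_laplacian_eq_newtonMass_mul hΩ hb
    (contDiffOn_const.mul hg : ContDiffOn ℝ 2 (fun x => (newtonMass E)⁻¹ * g x) Ω)
    (C := ‖(newtonMass E)⁻¹‖ * C) (fun x hx => by
      rw [norm_mul]
      exact mul_le_mul_of_nonneg_left (hC x hx) (norm_nonneg _))
  exact ⟨V, hV, fun x hx => by rw [hΔ x hx, mul_inv_cancel_left₀ hm.ne']⟩

end Poisson

/-! ### The second derivative test. -/

section LocalMin

variable {E : Type*} [NormedAddCommGroup E] [NormedSpace ℝ E]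

/-- The second derivative test, for a positive definite second derivative. -/
theorem eventually_lt_of_fderiv_eq_zero_of_le_fderiv_fderiv {V : E → ℝ}
    (hV : ContDiffAt ℝ 2 V 0) (h0 : fderiv ℝ V 0 = 0) {c : ℝ} (hc : 0 < c)
    (h : ∀ v, c * ‖v‖ ^ 2 ≤ fderiv ℝ (fderiv ℝ V) 0 v v) :
    ∀ᶠ x in 𝓝[≠] (0 : E), V 0 < V x := by
  have hd : HasFDerivAt (fderiv ℝ V) (fderiv ℝ (fderiv ℝ V) 0) 0 :=
    ((hV.fderiv_right (m := 1) (by norm_num)).differentiableAt one_ne_zero).hasFDerivAt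
  -- The Hessian contributes at least `c * ‖x‖²` and the linearisation error at most half of that;
  -- hence `V` increases strictly along rays from the origin.
  have h1 : ∀ᶠ x in 𝓝 (0 : E), x ≠ 0 → 0 < fderiv ℝ V x x := by
    filter_upwards [hd.isLittleO.def (half_pos hc)] with x hx hx0
    have hx' : 0 < ‖x‖ := norm_pos_iff.2 hx0
    rw [h0, sub_zero, sub_zero] at hx
    have h2 := (fderiv ℝ V x - fderiv ℝ (fderiv ℝ V) 0 x).le_opNorm x
    rw [sub_apply, Real.norm_eq_abs, abs_le] at h2
    have h3 := mul_le_mul_of_nonneg_right hx hx'.le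
    nlinarith [h x, mul_pos hc (mul_pos hx' hx')]
  have h2 : ∀ᶠ x in 𝓝 (0 : E), DifferentiableAt ℝ V x :=
    (hV.eventually (by simp)).mono fun x hx => hx.differentiableAt two_ne_zero
  obtain ⟨δ, hδ, hball⟩ := Metric.eventually_nhds_iff_ball.1 (h1.and h2)
  rw [eventually_nhdsWithin_iff]
  filter_upwards [Metric.ball_mem_nhds (0 : E) hδ] with x hx hx0
  have hx0 : x ≠ 0 := hx0
  have hmem : ∀ t ∈ Icc (0 : ℝ) 1, t • x ∈ Metric.ball (0 : E) δ := by
    intro t ht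
    rw [mem_ball_zero_iff] at hx ⊢
    rw [norm_smul, Real.norm_of_nonneg ht.1]
    nlinarith [norm_nonneg x, ht.2]
  have hderiv : ∀ t ∈ Icc (0 : ℝ) 1, HasDerivAt (fun t : ℝ => V (t • x))
      (fderiv ℝ V (t • x) x) t := by
    intro t ht
    have h3 : HasDerivAt (fun t : ℝ => t • x) x t := by
      simpa using (hasDerivAt_id t).smul_const x
    exact (hball _ (hmem t ht)).2.hasFDerivAt.comp_hasDerivAt t h3
  have hmono : StrictMonoOn (fun t : ℝ => V (t • x)) (Icc 0 1) := by
    refine strictMonoOn_of_deriv_pos (convex_Icc 0 1)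
      (fun t ht => (hderiv t ht).continuousAt.continuousWithinAt) fun t ht => ?_
    rw [interior_Icc] at ht
    rw [(hderiv t (Ioo_subset_Icc_self ht)).deriv]
    have h3 := (hball _ (hmem t (Ioo_subset_Icc_self ht))).1 (smul_ne_zero ht.1.ne' hx0)
    rw [map_smul, smul_eq_mul] at h3
    exact pos_of_mul_pos_right h3 ht.1.le
  simpa using hmono (left_mem_Icc.2 zero_le_one) (right_mem_Icc.2 zero_le_one) zero_lt_one

end LocalMin

/-! ### The harmonic quadratic correction. -/

section Correction

variable {E : Type*} [NormedAddCommGroup E] [InnerProductSpace ℝ E]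

/-- The quadratic polynomial with value `0` and derivative `-L` at the origin, whose second
derivative is `c • ⟪·, ·⟫` minus the symmetric part of `B`. -/
noncomputable def quadraticCorrection (c : ℝ) (B : E →L[ℝ] E →L[ℝ] ℝ) (L : E →L[ℝ] ℝ) (x : E) : ℝ :=
  2⁻¹ * (c * ‖x‖ ^ 2 - B x x) - L x

variable (c : ℝ) (B : E →L[ℝ] E →L[ℝ] ℝ) (L : E →L[ℝ] ℝ)

theorem contDiff_quadraticCorrection {n : WithTop ℕ∞} :
    ContDiff ℝ n (quadraticCorrection c B L) :=
  (contDiff_const.mul ((contDiff_const.mul (contDiff_norm_sq ℝ)).sub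
    (B.contDiff.clm_apply contDiff_id))).sub L.contDiff

theorem fderiv_quadraticCorrection_apply (x v : E) :
    fderiv ℝ (quadraticCorrection c B L) x v =
      c * inner ℝ x v - 2⁻¹ * (B x v + B v x) - L v := by
  have h1 : HasFDerivAt (fun x : E => ‖x‖ ^ 2) (2 • innerSL ℝ x) x :=
    (hasStrictFDerivAt_norm_sq x).hasFDerivAt
  have h2 : HasFDerivAt (fun x => B x x) _ x := B.hasFDerivAt.clm_apply (hasFDerivAt_id x)
  have h3 : HasFDerivAt (quadraticCorrection c B L) _ x :=
    (((h1.const_mul c).sub h2).const_mul 2⁻¹).sub L.hasFDerivAt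
  rw [h3.fderiv]
  simp
  ring

theorem fderiv_fderiv_quadraticCorrection (x v : E) :
    fderiv ℝ (fderiv ℝ (quadraticCorrection c B L)) x v v = c * ‖v‖ ^ 2 - B v v := by
  rw [← fderiv_fderiv_apply (contDiff_quadraticCorrection c B L).contDiffAt]
  simp_rw [fderiv_quadraticCorrection_apply]
  have h1 : HasFDerivAt (fun z : E => inner ℝ z v) (innerSL ℝ v) x := by
    simpa [real_inner_comm] using (innerSL ℝ v).hasFDerivAt (x := x)
  have h2 : HasFDerivAt (fun z => B z v) (B.flip v) x := (B.flip v).hasFDerivAt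
  have h3 : HasFDerivAt (fun z => c * inner ℝ z v - 2⁻¹ * (B z v + B v z) - L v) _ x :=
    ((h1.const_mul c).sub ((h2.add (B v).hasFDerivAt).const_mul 2⁻¹)).sub_const (L v)
  rw [h3.fderiv]
  simp
  ring

theorem laplacian_quadraticCorrection {ι : Type*} [FiniteDimensional ℝ E] [Fintype ι]
    (b : OrthonormalBasis ι ℝ E) (x : E) :
    Laplacian.laplacian (quadraticCorrection c B L) x =
      c * finrank ℝ E - ∑ i, B (b i) (b i) := by
  rw [laplacian_eq_sum_fderiv_fderiv b]
  simp_rw [fderiv_fderiv_quadraticCorrection]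
  simp [Finset.sum_sub_distrib, finrank_eq_card_basis b.toBasis, mul_comm]

/-- A function of class `C²` near the origin with positive Laplacian there becomes, after the
addition of a harmonic polynomial, a function with a strict local minimum at the origin. -/
theorem exists_harmonic_add_strict_local_min [FiniteDimensional ℝ E] [Nontrivial E] {V : E → ℝ}
    (hV : ContDiffAt ℝ 2 V 0) (hpos : 0 < Laplacian.laplacian V 0) :
    ∃ q : E → ℝ, ContDiff ℝ 3 q ∧ (∀ x, Laplacian.laplacian q x = 0) ∧
      ∀ᶠ x in 𝓝[≠] (0 : E), (V + q) 0 < (V + q) x := by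
  have hd : (0 : ℝ) < finrank ℝ E := by exact_mod_cast finrank_pos
  set B := fderiv ℝ (fderiv ℝ V) 0
  set L := fderiv ℝ V 0
  -- The mean of the Hessian's eigenvalues: the only `c` for which `c I` and the Hessian have equal
  -- trace, hence for which the correction is harmonic.
  set c := (Laplacian.laplacian V 0 : ℝ) / finrank ℝ E with hc
  have hcpos : 0 < c := div_pos hpos hd
  have hq : ContDiffAt ℝ 2 (quadraticCorrection c B L) 0 :=
    (contDiff_quadraticCorrection c B L).contDiffAt
  refine ⟨quadraticCorrection c B L, contDiff_quadraticCorrection c B L, fun x => ?_, ?_⟩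
  · rw [laplacian_quadraticCorrection c B L (stdOrthonormalBasis ℝ E),
      ← laplacian_eq_sum_fderiv_fderiv, hc, div_mul_cancel₀ _ hd.ne', sub_self]
  · refine eventually_lt_of_fderiv_eq_zero_of_le_fderiv_fderiv (hV.add hq) ?_ hcpos fun v => ?_
    · ext v
      rw [fderiv_add (hV.differentiableAt two_ne_zero) (hq.differentiableAt two_ne_zero), add_apply,
        fderiv_quadraticCorrection_apply]
      simp [L]
    · have h1 : fderiv ℝ (V + quadraticCorrection c B L) =ᶠ[𝓝 0]
          fderiv ℝ V + fderiv ℝ (quadraticCorrection c B L) := by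
        filter_upwards [hV.eventually (by simp), hq.eventually (by simp)] with z hz1 hz2
        exact fderiv_add (hz1.differentiableAt two_ne_zero) (hz2.differentiableAt two_ne_zero)
      rw [h1.fderiv_eq, fderiv_add
        ((hV.fderiv_right (m := 1) (by norm_num)).differentiableAt one_ne_zero)
        ((hq.fderiv_right (m := 1) (by norm_num)).differentiableAt one_ne_zero), add_apply,
        add_apply, fderiv_fderiv_quadraticCorrection]
      simp [B]

end Correction

/-! ### Bounds up to the boundary, and divergence in coordinates. -/

section Divergence

/-- The derivative of a function of class `C¹` on the closure of a bounded open set is bounded. -/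
theorem exists_norm_fderiv_le_of_contDiffOn_closure {E F : Type*} [NormedAddCommGroup E]
    [NormedSpace ℝ E] [ProperSpace E] [NormedAddCommGroup F] [NormedSpace ℝ F] {Ω : Set E}
    (hΩ : IsOpen Ω) (hb : Bornology.IsBounded Ω) {f : E → F} (hf : ContDiffOn ℝ 1 f (closure Ω)) :
    ∃ C, ∀ x ∈ Ω, ‖fderiv ℝ f x‖ ≤ C := by
  have hK : IsCompact (closure Ω) := hb.isCompact_closure
  have key : ∃ C, ∀ x ∈ closure Ω ∩ Ω, ‖fderiv ℝ f x‖ ≤ C := by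
    refine hK.induction_on (p := fun s => ∃ C, ∀ x ∈ s ∩ Ω, ‖fderiv ℝ f x‖ ≤ C)
      ⟨0, by simp⟩ ?_ ?_ ?_
    · rintro s t hst ⟨C, hC⟩
      exact ⟨C, fun x hx => hC x ⟨hst hx.1, hx.2⟩⟩
    · rintro s t ⟨C, hC⟩ ⟨D, hD⟩
      refine ⟨max C D, ?_⟩
      rintro x ⟨hx | hx, hxΩ⟩
      · exact (hC x ⟨hx, hxΩ⟩).trans (le_max_left _ _)
      · exact (hD x ⟨hx, hxΩ⟩).trans (le_max_right _ _)
    -- At a boundary point `fderiv ℝ f` says nothing about `f` on `closure Ω`. The bound comes from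
    -- a derivative within `closure Ω` that is continuous at `x`; at nearby points of `Ω` it is the
    -- full derivative.
    · intro x hx
      have h1 : ContDiffWithinAt ℝ (0 + 1) f (closure Ω) x := by simpa using hf x hx
      obtain ⟨u, hu, -, f', hf', hc⟩ :=
        (contDiffWithinAt_succ_iff_hasFDerivWithinAt (by simp)).1 h1
      rw [insert_eq_of_mem hx] at hu
      have hxu : x ∈ u := mem_of_mem_nhdsWithin hx hu
      have hlt : ∀ᶠ y in 𝓝[u] x, ‖f' y‖ < ‖f' x‖ + 1 :=
        hc.continuousWithinAt.norm.eventually_lt continuousWithinAt_const (by simp)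
      obtain ⟨O, hO, hxO, hOu⟩ := mem_nhdsWithin.1 hu
      obtain ⟨O', hO', hxO', hOu'⟩ := mem_nhdsWithin.1 hlt
      refine ⟨O ∩ O' ∩ closure Ω, ?_, ‖f' x‖ + 1, ?_⟩
      · exact inter_mem (mem_nhdsWithin_of_mem_nhds ((hO.inter hO').mem_nhds ⟨hxO, hxO'⟩))
          self_mem_nhdsWithin
      · rintro y ⟨⟨⟨hyO, hyO'⟩, hyc⟩, hyΩ⟩
        have hyu : y ∈ u := hOu ⟨hyO, hyc⟩
        have hun : u ∈ 𝓝 y := by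
          filter_upwards [hO.mem_nhds hyO, hΩ.mem_nhds hyΩ] with z hz1 hz2
          exact hOu ⟨hz1, subset_closure hz2⟩
        rw [((hf' y hyu).hasFDerivAt hun).fderiv]
        exact le_of_lt (hOu' ⟨hyO', hyu⟩)
  obtain ⟨C, hC⟩ := key
  exact ⟨C, fun x hx => hC x ⟨subset_closure hx, hx⟩⟩

variable {n : ℕ}

local notation "𝔼" => EuclideanSpace ℝ (Fin n)

theorem gradient_apply (V : 𝔼 → ℝ) (x : 𝔼) (i : Fin n) :
    gradient V x i = fderiv ℝ V x (EuclideanSpace.single i 1) := by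
  simpa using (EuclideanSpace.inner_single_right i (1 : ℝ) (gradient V x)).symm

theorem fderiv_apply_coord {F : 𝔼 → 𝔼} {x : 𝔼} (hF : DifferentiableAt ℝ F x) (v : 𝔼) (i : Fin n) :
    fderiv ℝ F x v i = fderiv ℝ (fun z => F z i) x v := by
  have h := (EuclideanSpace.proj (𝕜 := ℝ) i : 𝔼 →L[ℝ] ℝ).hasFDerivAt.comp x hF.hasFDerivAt
  have h' : HasFDerivAt (fun z => F z i) _ x := h
  rw [h'.fderiv]
  rfl

theorem ContDiffOn.gradient_of_isOpen {Ω : Set 𝔼} (hΩ : IsOpen Ω) {V : 𝔼 → ℝ}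
    (hV : ContDiffOn ℝ 3 V Ω) : ContDiffOn ℝ 2 (gradient V) Ω := by
  rw [contDiffOn_euclidean]
  intro i
  simp_rw [gradient_apply]
  exact (hV.fderiv_of_isOpen hΩ (by norm_num)).clm_apply contDiffOn_const

theorem divergence_gradient {V : 𝔼 → ℝ} {x : 𝔼} (hV : ContDiffAt ℝ 2 V x)
    (hg : DifferentiableAt ℝ (gradient V) x) :
    divergence (gradient V) x = Laplacian.laplacian V x := by
  rw [laplacian_eq_sum_fderiv (EuclideanSpace.basisFun (Fin n) ℝ) hV, divergence]
  refine Finset.sum_congr rfl fun i _ => ?_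
  rw [fderiv_apply_coord hg]
  simp_rw [gradient_apply, EuclideanSpace.basisFun_apply]

theorem divergence_add {F G : 𝔼 → 𝔼} {x : 𝔼} (hF : DifferentiableAt ℝ F x)
    (hG : DifferentiableAt ℝ G x) :
    divergence (F + G) x = divergence F x + divergence G x := by
  simp [divergence, fderiv_add hF hG, Finset.sum_add_distrib]

theorem contDiffOn_divergence {Ω : Set 𝔼} (hΩ : IsOpen Ω) {F : 𝔼 → 𝔼}
    (hF : ContDiffOn ℝ 3 F Ω) : ContDiffOn ℝ 2 (divergence F) Ω := by
  refine ContDiffOn.sum fun i _ => ?_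
  exact contDiffOn_euclidean.1
    ((hF.fderiv_of_isOpen hΩ (by norm_num)).clm_apply contDiffOn_const) i

theorem abs_divergence_le (F : 𝔼 → 𝔼) (x : 𝔼) :
    |divergence F x| ≤ n * ‖fderiv ℝ F x‖ := by
  calc |divergence F x| ≤ ∑ i : Fin n, |fderiv ℝ F x (EuclideanSpace.single i 1) i| :=
        Finset.abs_sum_le_sum_abs _ _
    _ ≤ ∑ _i : Fin n, ‖fderiv ℝ F x‖ := by
        refine Finset.sum_le_sum fun i _ => ?_
        refine (PiLp.norm_apply_le (fderiv ℝ F x (EuclideanSpace.single i 1)) i).trans ?_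
        simpa using (fderiv ℝ F x).le_opNorm (EuclideanSpace.single i (1 : ℝ))
    _ = _ := by simp

end Divergence

/-! ### Assembly of the decomposition. -/

theorem theorem1 {n : ℕ} (Ω : Set (EuclideanSpace ℝ (Fin n))) (hΩ : IsBoundedC2Domain Ω)
    (h0 : (0 : EuclideanSpace ℝ (Fin n)) ∈ Ω)
    (F : EuclideanSpace ℝ (Fin n) → EuclideanSpace ℝ (Fin n))
    (hF : ContDiffOn ℝ 3 F (closure Ω)) (hF0 : F 0 = 0) (hdiv : divergence F 0 < 0) :
    ∃ (V : EuclideanSpace ℝ (Fin n) → ℝ)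
      (u : EuclideanSpace ℝ (Fin n) → EuclideanSpace ℝ (Fin n)),
      IsHHD Ω F V u ∧ ∀ᶠ x in 𝓝[≠] (0 : EuclideanSpace ℝ (Fin n)), V 0 < V x := by
  -- In dimension zero the divergence is an empty sum, hence not negative.
  have hn : Nonempty (Fin n) := by
    by_contra h
    rw [not_nonempty_iff] at h
    simp [divergence] at hdiv
  have hnt : Nontrivial (EuclideanSpace ℝ (Fin n)) := by
    obtain ⟨i⟩ := hn
    exact ⟨EuclideanSpace.single i 1, 0, by simp⟩
  have hopen := hΩ.isOpen
  have hFΩ : ContDiffOn ℝ 3 F Ω := hF.mono subset_closure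
  obtain ⟨C, hC⟩ := exists_norm_fderiv_le_of_contDiffOn_closure hopen hΩ.isBounded
    (hF.of_le (by norm_num))
  -- Solves `ΔV = -div F`; the sign makes `ΔV(0)` positive and `F + ∇V` divergence free.
  obtain ⟨V, hV, hVΔ⟩ := exists_laplacian_eq hopen hΩ.isBounded
    (contDiffOn_divergence hopen hFΩ).neg (C := n * C) (fun x hx => by
      rw [norm_neg]
      exact (abs_divergence_le F x).trans (mul_le_mul_of_nonneg_left (hC x hx) n.cast_nonneg))
  have hV2 : ∀ x ∈ Ω, ContDiffAt ℝ 2 V x := fun x hx =>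
    (hV.contDiffAt (hopen.mem_nhds hx)).of_le (by norm_num)
  obtain ⟨q, hq, hqΔ, hmin⟩ := exists_harmonic_add_strict_local_min (hV2 0 h0) (by
    rw [hVΔ 0 h0]
    linarith)
  have hVq : ContDiffOn ℝ 3 (V + q) Ω := hV.add hq.contDiffOn
  have hgrad := hVq.gradient_of_isOpen hopen
  refine ⟨V + q, F + gradient (V + q), ⟨hVq, (hFΩ.of_le (by norm_num)).add hgrad, ?_, ?_⟩, hmin⟩
  · intro x hx
    have hx' := hopen.mem_nhds hx
    have hg := (hgrad.contDiffAt hx').differentiableAt two_ne_zero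
    have hq2 : ContDiffAt ℝ 2 q x := (hq.of_le (by norm_num)).contDiffAt
    rw [divergence_add ((hFΩ.contDiffAt hx').differentiableAt three_ne_zero) hg,
      divergence_gradient (V := V + q) ((hV2 x hx).add hq2) hg, (hV2 x hx).laplacian_add hq2, hVΔ x hx, hqΔ x]
    simp
  · intro x _
    simp
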